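/- Let $q$ be a real-valued $C^\infty$ function defined in an open neighborhood of $[0,1]$, and consider the Dirichlet Sturm--Liouville problem $$-y''(x)+q(x)\,y(x)=\lambda\,y(x)\ \text{ in } ]0,1[\,,\qquad y(0)=y(1)=0 .$$ Let $n\ge 1$, let $\lambda_1<\lambda_2<\dots<\lambda_n$ be its $n$ smallest eigenvalues, and let $h_1,\dots,h_n$ be associated real eigenfunctions, orthonormal in $L^2(]0,1[)$. For $\vec b=(b_1,\dots,b_n)\in\mathbb{R}^n$ put $S_{\vec b}(x)=\sum_{j=1}^n b_j h_j(x)$, and for $x_1,\dots,x_n\in[0,1]$ let $$\mathfrak{S}_n(x_1,\dots,x_n)=\det\big(h_i(x_j)\big)_{1\le i,j\le n}$$ be the Slater determinant. Let $\vec b\neq\vec 0$. Then $S_{\vec b}$ has at most $n-1$ distinct zeros in $]0,1[$. If $S_{\vec b}$ has exactly $n-1$ distinct zeros $c_1<\dots<c_{n-1}$ in $]0,1[$, then there is a constant $C\neq 0$ such that $$S_{\vec b}(x)=C\,\mathfrak{S}_n(c_1,\dots,c_{n-1},x)\quad\text{for all } x\in[0,1],$$ and each zero $c_j$ of $S_{\vec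 b}$ has order $1$, i.e. $S_{\vec b}'(c_j)\neq 0$. -/

import Mathlib

open Set
open scoped ContDiff

/-- `y` is a Dirichlet eigenfunction of `-d²/dx² + q` on `]0,1[` for the eigenvalue `μ`: it is
continuous on `[0,1]`, of class `C²` on `]0,1[`, solves `-y'' + q y = μ y` there, vanishes at both
end points, and is not identically zero. Values of `y` outside `[0,1]` play no role. -/
structure IsDirichletEigenfunction (q : ℝ → ℝ) (μ : ℝ) (y : ℝ → ℝ) : Prop where
  continuousOn : ContinuousOn y (Icc 0 1)
  contDiffOn : ContDiffOn ℝ 2 y (Ioo 0 1)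
  equation : ∀ x ∈ Ioo (0 : ℝ) 1, -deriv (deriv y) x + q x * y x = μ * y x
  left : y 0 = 0
  right : y 1 = 0
  ne_zero : ∃ x ∈ Ioo (0 : ℝ) 1, y x ≠ 0

/-- `μ` is a Dirichlet eigenvalue of `-d²/dx² + q` on `]0,1[`. -/
def IsDirichletEigenvalue (q : ℝ → ℝ) (μ : ℝ) : Prop :=
  ∃ y : ℝ → ℝ, IsDirichletEigenfunction q μ y

/-- `lam 0 < lam 1 < ⋯ < lam (n - 1)` are the `n` smallest Dirichlet eigenvalues of
`-d²/dx² + q` on `]0,1[`, and `h 0, …, h (n - 1)` are associated eigenfunctions, orthonormal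
in `L²(]0,1[)`. -/
structure IsFirstDirichletEigenpairs (q : ℝ → ℝ) {n : ℕ} (lam : Fin n → ℝ)
    (h : Fin n → ℝ → ℝ) : Prop where
  strictMono : StrictMono lam
  eigenfunction : ∀ j, IsDirichletEigenfunction q (lam j) (h j)
  /-- No eigenvalue is skipped. -/
  first : ∀ μ, IsDirichletEigenvalue q μ → ∀ j, μ ≤ lam j → μ ∈ range lam
  orthonormal : ∀ i j, ∫ x in (0 : ℝ)..1, h i x * h j x = if i = j then 1 else 0

/-- The linear combination `S_b = ∑ b_j h_j`. -/
def linComb {n : ℕ} (h : Fin n → ℝ → ℝ) (b : Fin n → ℝ) (x : ℝ) : ℝ :=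
  ∑ j, b j * h j x

/-- The Slater determinant `𝔖_n(x_1, …, x_n) = det (h_i (x_j))`. -/
def slater {n : ℕ} (h : Fin n → ℝ → ℝ) (x : Fin n → ℝ) : ℝ :=
  (Matrix.of fun i j => h i (x j)).det

/-- `f` vanishes at `c` at order exactly `k`. -/
def IsZeroOfOrder (f : ℝ → ℝ) (c : ℝ) (k : ℕ) : Prop :=
  (∀ i < k, iteratedDeriv i f c = 0) ∧ iteratedDeriv k f c ≠ 0

/-! The argument is Liouville's. Write `S` for a nonzero combination of the first `m + 1`
eigenfunctions. The eigenfunction `y 0` has no zero in `]0,1[`. Rolle applied to `S / y 0`, then to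
the Wronskian of `S` and `y 0`, shows that `-S'' + (Q - lam 0) S` has at least as many zeros in
`]0,1[` as `S`, and one more for each zero of `S` known to be multiple
(`exists_finset_zeros_liouville`). On coefficients this operator is multiplication by `lam j - lam
0`, so its normalised iterates converge to the top term of `S`. Zeros survive the limit because that
term has only simple zeros, so `S` has at most as many zeros as a single eigenfunction, hence at
most `m` (`card_zeros_linComb_le`).

With exactly `m` zeros, a multiple one would give a combination with `m + 1` zeros. The Slater
formula is linear algebra: the Chebyshev property makes evaluation at `m + 1` distinct points
injective on coefficients.

The oscillation bound, at most `j` zeros for the eigenfunction of index `j`, comes from the Prüfer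
angle: too many zeros would force, by continuity in the spectral parameter, more eigenvalues below
`lam j` than there are (`exists_solutionPairs`). -/

open Filter Topology

/-! ### The Prüfer angle. -/

/-- The vector field of the Prüfer angle equation for `y'' = (Q - μ) y`. -/
noncomputable def pruferField (Q : ℝ → ℝ) (μ x t : ℝ) : ℝ :=
  Real.cos t ^ 2 + (μ - Q x) * Real.sin t ^ 2

/-- `θ` is the Prüfer angle on `[0,1]` of the solution of `y'' = (Q - μ) y` with `y 0 = 0`. -/
structure IsPruferAngle (Q : ℝ → ℝ) (μ : ℝ) (θ : ℝ → ℝ) : Prop where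
  continuous : Continuous θ
  zero : θ 0 = 0
  hasDerivWithinAt : ∀ x ∈ Icc (0 : ℝ) 1,
    HasDerivWithinAt θ (pruferField Q μ x (θ x)) (Icc 0 1) x

/-- `y` solves `y'' = (Q - μ) y` on `]0,1[` with derivative `v`, `y 0 = 0` and `(y, v)` never
vanishes. -/
structure IsSolutionPair (Q : ℝ → ℝ) (μ : ℝ) (y v : ℝ → ℝ) : Prop where
  continuous_fst : Continuous y
  continuous_snd : Continuous v
  hasDerivAt_fst : ∀ x ∈ Ioo (0 : ℝ) 1, HasDerivAt y (v x) x
  hasDerivAt_snd : ∀ x ∈ Ioo (0 : ℝ) 1, HasDerivAt v ((Q x - μ) * y x) x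
  zero : y 0 = 0
  nondegenerate : ∀ x, y x = 0 → v x ≠ 0

lemma pruferField_lipschitzWith {Q : ℝ → ℝ} {M : ℝ} (hM : ∀ x, |Q x| ≤ M) (μ x : ℝ) :
    LipschitzWith (2 * (1 + |μ| + M)).toNNReal (pruferField Q μ x) := by
  have hd : ∀ t, HasDerivAt (pruferField Q μ x)
      (2 * (μ - Q x - 1) * (Real.sin t * Real.cos t)) t := by
    intro t
    have := ((Real.hasDerivAt_cos t).pow 2).add
      (((Real.hasDerivAt_sin t).pow 2).const_mul (μ - Q x))
    refine this.congr_deriv ?_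
    simp; ring
  refine lipschitzWith_of_nnnorm_deriv_le (fun t => (hd t).differentiableAt) fun t => ?_
  rw [(hd t).deriv, ← NNReal.coe_le_coe, coe_nnnorm, Real.norm_eq_abs,
    Real.coe_toNNReal _ (by have := abs_nonneg μ; have := (abs_nonneg _).trans (hM x); linarith),
    abs_mul, abs_mul, abs_mul]
  have h1 : |μ - Q x - 1| ≤ 1 + |μ| + M := by
    have h2 := abs_sub (μ - Q x) 1
    have h3 := abs_sub μ (Q x)
    have := hM x
    rw [abs_one] at h2
    linarith
  have h4 : |Real.sin t| * |Real.cos t| ≤ 1 :=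
    mul_le_one₀ (Real.abs_sin_le_one t) (abs_nonneg _) (Real.abs_cos_le_one t)
  rw [abs_two]
  nlinarith [abs_nonneg (μ - Q x - 1), mul_nonneg (abs_nonneg (Real.sin t)) (abs_nonneg (Real.cos t))]

/-- The field is bounded by `1 + |μ| + M` and the time interval has length one, so a ball of that
radius about `0` is large enough for Picard–Lindelöf on all of `[0,1]`. -/
lemma exists_isPruferAngle {Q : ℝ → ℝ} (hQ : Continuous Q) {M : ℝ} (hM : ∀ x, |Q x| ≤ M)
    (μ : ℝ) : ∃ θ, IsPruferAngle Q μ θ := by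
  have hM0 : 0 ≤ M := (abs_nonneg _).trans (hM 0)
  have hL0 : 0 ≤ 1 + |μ| + M := by have := abs_nonneg μ; linarith
  have hpl : IsPicardLindelof (pruferField Q μ) (tmin := 0) (tmax := 1) ⟨0, by simp⟩ (0 : ℝ)
      (1 + |μ| + M).toNNReal 0 (1 + |μ| + M).toNNReal (2 * (1 + |μ| + M)).toNNReal := by
    refine ⟨fun t _ => (pruferField_lipschitzWith hM μ t).lipschitzOnWith, fun t _ => ?_,
      fun t _ x _ => ?_, by simp⟩
    · unfold pruferField; fun_prop
    · rw [Real.coe_toNNReal _ hL0, Real.norm_eq_abs, pruferField]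
      have h1 := Real.sin_sq_add_cos_sq x
      have h2 := abs_sub μ (Q t)
      have h3 := hM t
      calc _ ≤ |Real.cos x ^ 2| + |(μ - Q t) * Real.sin x ^ 2| := abs_add_le _ _
        _ = Real.cos x ^ 2 + |μ - Q t| * Real.sin x ^ 2 := by
          rw [abs_mul, abs_of_nonneg (sq_nonneg (Real.cos x)),
            abs_of_nonneg (sq_nonneg (Real.sin x))]
        _ ≤ 1 + |μ - Q t| * 1 := by
          gcongr
          · nlinarith [sq_nonneg (Real.sin x)]
          · nlinarith [sq_nonneg (Real.cos x)]
        _ ≤ _ := by linarith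
  obtain ⟨α, h0, hα⟩ := hpl.exists_eq_forall_mem_Icc_hasDerivWithinAt₀
  have hc : ContinuousOn α (Icc 0 1) := fun x hx => (hα x hx).continuousWithinAt
  have he : ∀ x ∈ Icc (0 : ℝ) 1, IccExtend zero_le_one ((Icc 0 1).domRestrict α) x = α x :=
    fun x hx => IccExtend_of_mem _ _ hx
  refine ⟨IccExtend zero_le_one ((Icc 0 1).domRestrict α), ?_, ?_, fun x hx => ?_⟩
  · exact (continuousOn_iff_continuous_domRestrict.1 hc).Icc_extend'
  · rw [he 0 (by simp)]; exact h0
  · rw [he x hx]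
    exact (hα x hx).congr he (he x hx)

namespace IsPruferAngle

variable {Q : ℝ → ℝ} {μ : ℝ} {θ : ℝ → ℝ}

lemma hasDerivAt (h : IsPruferAngle Q μ θ) {x : ℝ} (hx : x ∈ Ioo (0 : ℝ) 1) :
    HasDerivAt θ (pruferField Q μ x (θ x)) x :=
  (h.hasDerivWithinAt x (Ioo_subset_Icc_self hx)).hasDerivAt (Icc_mem_nhds hx.1 hx.2)

lemma hasDerivWithinAt_Ici (h : IsPruferAngle Q μ θ) {x : ℝ} (hx : x ∈ Ico (0 : ℝ) 1) :
    HasDerivWithinAt θ (pruferField Q μ x (θ x)) (Ici x) x :=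
  (h.hasDerivWithinAt x (Ico_subset_Icc_self hx)).mono_of_mem_nhdsWithin
    (Icc_mem_nhdsGE_of_mem hx)

/-- The Prüfer radius satisfies a linear equation once the angle is known, so it is an exponential.
Its positivity makes the zeros of the solution those of `sin θ`. -/
lemma exists_isSolutionPair (h : IsPruferAngle Q μ θ) (hQ : Continuous Q) :
    ∃ r : ℝ → ℝ, (∀ x, 0 < r x) ∧
      IsSolutionPair Q μ (fun x => r x * Real.sin (θ x)) (fun x => r x * Real.cos (θ x)) := by
  have hθ := h.continuous
  set g : ℝ → ℝ := fun x => (1 + Q x - μ) * (Real.sin (θ x) * Real.cos (θ x)) with hg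
  have hgc : Continuous g := by fun_prop
  have hr : ∀ x, HasDerivAt (fun x => Real.exp (∫ t in (0 : ℝ)..x, g t))
      (Real.exp (∫ t in (0 : ℝ)..x, g t) * g x) x := fun x =>
    (intervalIntegral.integral_hasDerivAt_right (hgc.intervalIntegrable _ _)
      (hgc.stronglyMeasurableAtFilter _ _) hgc.continuousAt).exp
  have hrc : Continuous (fun x => Real.exp (∫ t in (0 : ℝ)..x, g t)) :=
    continuous_iff_continuousAt.2 fun x => (hr x).continuousAt
  refine ⟨fun x => Real.exp (∫ t in (0 : ℝ)..x, g t), fun x => Real.exp_pos _, ?_, ?_, ?_, ?_,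
    ?_, ?_⟩
  · fun_prop
  · fun_prop
  · intro x hx
    refine ((hr x).mul (h.hasDerivAt hx).sin).congr_deriv ?_
    simp only [hg, pruferField]
    linear_combination (Real.exp (∫ t in (0 : ℝ)..x, g t)) * Real.cos (θ x) *
      Real.sin_sq_add_cos_sq (θ x)
  · intro x hx
    refine ((hr x).mul (h.hasDerivAt hx).cos).congr_deriv ?_
    simp only [hg, pruferField]
    linear_combination (Real.exp (∫ t in (0 : ℝ)..x, g t)) * (Q x - μ) * Real.sin (θ x) *
      Real.sin_sq_add_cos_sq (θ x)
  · simp [h.zero]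
  · intro x hs hc
    have h1 := (mul_eq_zero.1 hs).resolve_left (Real.exp_pos _).ne'
    have h2 := (mul_eq_zero.1 hc).resolve_left (Real.exp_pos _).ne'
    have := Real.sin_sq_add_cos_sq (θ x)
    simp [h1, h2] at this

/-- Multiples of `π` are crossed upwards. -/
lemma lt_of_eq_mul_pi (h : IsPruferAngle Q μ θ) {k : ℤ} {a x : ℝ} (ha : 0 ≤ a) (hax : a < x)
    (hx : x ≤ 1) (hk : θ a = k * Real.pi) : k * Real.pi < θ x := by
  have hfield : ∀ z, θ z = k * Real.pi → pruferField Q μ z (θ z) = 1 := by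
    intro z hz
    have hs : Real.sin (θ z) = 0 := by rw [hz]; exact Real.sin_int_mul_pi k
    have := Real.sin_sq_add_cos_sq (θ z)
    rw [hs] at this
    simp [pruferField, hs]
    simpa using this
  -- The constant is a lower barrier, since the angle has slope `1` wherever it touches it.
  have hle : ∀ z ∈ Icc a x, k * Real.pi ≤ θ z := by
    intro z hz
    refine image_le_of_deriv_right_lt_deriv_boundary' (f := fun _ => k * Real.pi)
      (f' := fun _ => 0) (B' := fun z => pruferField Q μ z (θ z)) continuousOn_const
      (fun z _ => hasDerivWithinAt_const _ _ _) hk.ge h.continuous.continuousOn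
      (fun z hz => h.hasDerivWithinAt_Ici ⟨ha.trans hz.1, hz.2.trans_le hx⟩)
      (fun z _ he => ?_) hz
    rw [hfield z he.symm]; exact zero_lt_one
  refine lt_of_le_of_ne (hle x ⟨hax.le, le_rfl⟩) fun he => ?_
  have hd : HasDerivWithinAt θ 1 (Icc a x) x := by
    have := (h.hasDerivWithinAt x ⟨ha.trans hax.le, hx⟩).mono (Icc_subset_Icc ha hx)
    rwa [hfield x he.symm] at this
  -- Touching the level again at `x` would make `x` a minimum from the left, so the left slopes
  -- would be nonpositive, against derivative `1`.
  have hmin : IsMinOn θ (Icc a x) x := fun z hz => by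
    show θ x ≤ θ z
    rw [← he]; exact hle z hz
  have hs : Tendsto (slope θ x) (𝓝[Icc a x \ {x}] x) (𝓝 1) := hasDerivWithinAt_iff_tendsto_slope.1 hd
  have hne : (𝓝[Icc a x \ {x}] x).NeBot := by
    rw [Icc_sdiff_right]
    rw [nhdsWithin_Ico_eq_nhdsLT hax]
    infer_instance
  have : (1 : ℝ) ≤ 0 := by
    refine le_of_tendsto hs ?_
    filter_upwards [self_mem_nhdsWithin] with z hz
    rw [slope_def_field]
    refine div_nonpos_of_nonneg_of_nonpos (sub_nonneg.2 (hmin hz.1)) ?_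
    linarith [hz.1.2]
  linarith

/-- At angle `π / 2` the field equals `μ - Q x < 0`, so this level cannot be crossed upwards. -/
lemma le_pi_div_two (h : IsPruferAngle Q μ θ) (hμ : ∀ x, μ < Q x) : θ 1 ≤ Real.pi / 2 := by
  refine image_le_of_deriv_right_lt_deriv_boundary' (f := θ)
    (f' := fun z => pruferField Q μ z (θ z)) (B := fun _ => Real.pi / 2) (B' := fun _ => 0)
    h.continuous.continuousOn (fun z hz => h.hasDerivWithinAt_Ici hz)
    (by rw [h.zero]; positivity) continuousOn_const (fun z _ => hasDerivWithinAt_const _ _ _)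
    (fun z _ he => ?_) (right_mem_Icc.2 zero_le_one)
  have he : θ z = Real.pi / 2 := he
  simp [pruferField, he, hμ z]

end IsPruferAngle

/-- The end value of the Prüfer angle depends continuously on the spectral parameter. -/
lemma continuous_pruferAngle_one {Q : ℝ → ℝ} {M : ℝ} (hM : ∀ x, |Q x| ≤ M) {Θ : ℝ → ℝ → ℝ}
    (hΘ : ∀ μ, IsPruferAngle Q μ (Θ μ)) : Continuous fun μ => Θ μ 1 := by
  rw [continuous_iff_continuousAt]
  intro μ
  have hest : ∀ ν, dist (Θ ν 1) (Θ μ 1) ≤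
      gronwallBound 0 (2 * (1 + |μ| + M)).toNNReal (|ν - μ| + 0) (1 - 0) := by
    intro ν
    -- Grönwall: the angle for `ν` solves the equation for `μ` up to an error `|ν - μ|`.
    refine dist_le_of_approx_trajectories_ODE (pruferField_lipschitzWith hM μ)
      (hΘ ν).continuous.continuousOn (fun t ht => (hΘ ν).hasDerivWithinAt_Ici ht) (fun t _ => ?_)
      (hΘ μ).continuous.continuousOn (fun t ht => (hΘ μ).hasDerivWithinAt_Ici ht)
      (fun t _ => (dist_self _).le) ?_ 1 (right_mem_Icc.2 zero_le_one)
    · have : pruferField Q ν t (Θ ν t) - pruferField Q μ t (Θ ν t)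
          = (ν - μ) * Real.sin (Θ ν t) ^ 2 := by simp only [pruferField]; ring
      rw [Real.dist_eq, this, abs_mul, abs_of_nonneg (sq_nonneg (Real.sin (Θ ν t)))]
      exact mul_le_of_le_one_right (abs_nonneg _) (Real.sin_sq_le_one _)
    · simp [(hΘ ν).zero, (hΘ μ).zero]
  refine tendsto_iff_dist_tendsto_zero.2 (squeeze_zero (fun _ => dist_nonneg) hest ?_)
  have hc : Continuous fun ν => gronwallBound 0 (2 * (1 + |μ| + M)).toNNReal (|ν - μ| + 0)
      (1 - 0) := by
    unfold gronwallBound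
    split_ifs <;> fun_prop
  have := hc.tendsto μ
  simpa [gronwallBound_ε0_δ0] using this

/-! ### Eigenfunctions and the initial value problem. -/

lemma IsSolutionPair.isDirichletEigenvalue {q Q : ℝ → ℝ} (hQ : Continuous Q)
    (hqQ : ∀ x ∈ Ioo (0 : ℝ) 1, Q x = q x) {μ : ℝ} {y v : ℝ → ℝ} (h : IsSolutionPair Q μ y v)
    (h1 : y 1 = 0) : IsDirichletEigenvalue q μ := by
  have hdy : EqOn (deriv y) v (Ioo 0 1) := fun x hx => (h.hasDerivAt_fst x hx).deriv
  have hdv : EqOn (deriv v) (fun x => (Q x - μ) * y x) (Ioo 0 1) :=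
    fun x hx => (h.hasDerivAt_snd x hx).deriv
  have hy := h.continuous_fst
  refine ⟨y, hy.continuousOn, ?_, fun x hx => ?_, h.zero, h1, ?_⟩
  · have hv1 : ContDiffOn ℝ 1 v (Ioo 0 1) := by
      rw [show (1 : WithTop ℕ∞) = 0 + 1 by simp, contDiffOn_succ_iff_deriv_of_isOpen isOpen_Ioo]
      refine ⟨fun x hx => (h.hasDerivAt_snd x hx).differentiableAt.differentiableWithinAt,
        by simp, ?_⟩
      rw [contDiffOn_congr hdv, contDiffOn_zero]
      fun_prop
    rw [show (2 : WithTop ℕ∞) = 1 + 1 by norm_num, contDiffOn_succ_iff_deriv_of_isOpen isOpen_Ioo]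
    refine ⟨fun x hx => (h.hasDerivAt_fst x hx).differentiableAt.differentiableWithinAt,
      by simp, (contDiffOn_congr hdy).2 hv1⟩
  · have : deriv (deriv y) x = deriv v x :=
      (hdy.eventuallyEq_of_mem (Ioo_mem_nhds hx.1 hx.2)).deriv_eq
    rw [this, hdv hx, ← hqQ x hx]
    ring
  · by_contra! hc
    have hm : (1 / 2 : ℝ) ∈ Ioo (0 : ℝ) 1 := by norm_num
    refine h.nondegenerate _ (hc _ hm) ?_
    rw [← hdy hm]
    have : deriv y (1 / 2) = deriv (fun _ : ℝ => (0 : ℝ)) (1 / 2) :=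
      (EqOn.eventuallyEq_of_mem hc (Ioo_mem_nhds hm.1 hm.2)).deriv_eq
    simpa using this

/-- A Dirichlet eigenfunction is a multiple of the solution of the initial value problem. -/
lemma IsDirichletEigenfunction.exists_eq_mul {q Q : ℝ → ℝ} {M : ℝ} (hM : ∀ x, |Q x| ≤ M)
    (hqQ : ∀ x ∈ Ioo (0 : ℝ) 1, Q x = q x) {μ : ℝ} {f y v : ℝ → ℝ}
    (hf : IsDirichletEigenfunction q μ f) (h : IsSolutionPair Q μ y v) :
    ∃ A : ℝ, A ≠ 0 ∧ ∀ x ∈ Icc (0 : ℝ) 1, f x = A * y x := by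
  have hI : ∀ x ∈ Ioo (0 : ℝ) 1, Ioo (0 : ℝ) 1 ∈ 𝓝 x := fun x hx => Ioo_mem_nhds hx.1 hx.2
  have hf1 : ∀ x ∈ Ioo (0 : ℝ) 1, HasDerivAt f (deriv f x) x := fun x hx =>
    ((hf.contDiffOn.differentiableOn (by norm_num)).differentiableAt (hI x hx)).hasDerivAt
  have hf2 : ∀ x ∈ Ioo (0 : ℝ) 1, HasDerivAt (deriv f) ((Q x - μ) * f x) x := by
    intro x hx
    have hd : DifferentiableAt ℝ (deriv f) x := by
      have h2 := hf.contDiffOn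
      rw [show (2 : WithTop ℕ∞) = 1 + 1 by norm_num,
        contDiffOn_succ_iff_deriv_of_isOpen isOpen_Ioo] at h2
      exact (h2.2.2.differentiableOn (by norm_num)).differentiableAt (hI x hx)
    have := hd.hasDerivAt
    rwa [show deriv (deriv f) x = (Q x - μ) * f x by
      have := hf.equation x hx; rw [hqQ x hx]; linarith] at this
  obtain ⟨B, hB⟩ : ∃ B, ∀ x ∈ Icc (0 : ℝ) 1, |f x| ≤ B := by
    obtain ⟨B, hB⟩ := isCompact_Icc.exists_bound_of_continuousOn hf.continuousOn
    exact ⟨B, hB⟩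
  have hm : (1 / 2 : ℝ) ∈ Ioo (0 : ℝ) 1 := by norm_num
  -- An eigenfunction is only assumed continuous at `0`. Bounding its derivative near `0` is what
  -- lets the Wronskian tend to `0` there.
  have hbd : ∀ x ∈ Ioo (0 : ℝ) 1, |deriv f x| ≤ |deriv f (1 / 2)| + (M + |μ|) * B := by
    intro x hx
    have hB0 : 0 ≤ B := (abs_nonneg _).trans (hB 0 (by simp))
    have hM0 : 0 ≤ M := (abs_nonneg _).trans (hM 0)
    have := (convex_Ioo (0 : ℝ) 1).norm_image_sub_le_of_norm_hasDerivWithin_le (C := (M + |μ|) * B)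
      (fun z hz => (hf2 z hz).hasDerivWithinAt) (fun z hz => by
        rw [norm_mul, Real.norm_eq_abs, Real.norm_eq_abs]
        have h1 := abs_sub (Q z) μ
        have h2 := hM z
        exact mul_le_mul (by linarith) (hB z (Ioo_subset_Icc_self hz)) (abs_nonneg _)
          (by positivity)) hm hx
    have h3 : |x - 1 / 2| ≤ 1 := abs_le.2 ⟨by linarith [hx.1], by linarith [hx.2]⟩
    rw [Real.norm_eq_abs, Real.norm_eq_abs] at this
    have h4 : (M + |μ|) * B * |x - 1 / 2| ≤ (M + |μ|) * B :=
      mul_le_of_le_one_right (by positivity) h3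
    have h5 := abs_sub_abs_le_abs_sub (deriv f x) (deriv f (1 / 2))
    linarith
  -- the Wronskian is constant on `]0,1[` and tends to `0` at `0`
  have hW : ∀ x ∈ Ioo (0 : ℝ) 1, HasDerivAt (fun x => deriv f x * y x - f x * v x) 0 x := by
    intro x hx
    refine (((hf2 x hx).mul (h.hasDerivAt_fst x hx)).sub
      ((hf1 x hx).mul (h.hasDerivAt_snd x hx))).congr_deriv ?_
    ring
  obtain ⟨w, hw⟩ := isOpen_Ioo.exists_is_const_of_deriv_eq_zero isPreconnected_Ioo
    (fun x hx => (hW x hx).differentiableAt.differentiableWithinAt) (fun x hx => (hW x hx).deriv)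
  have hw0 : w = 0 := by
    have hev : ∀ᶠ x in 𝓝[>] (0 : ℝ), x ∈ Ioo (0 : ℝ) 1 := Ioo_mem_nhdsGT zero_lt_one
    have hy0 : Tendsto y (𝓝[>] 0) (𝓝 0) := by
      have := h.continuous_fst.tendsto 0
      rw [h.zero] at this
      exact this.mono_left nhdsWithin_le_nhds
    have hf0 : Tendsto f (𝓝[>] 0) (𝓝 0) := by
      have := hf.continuousOn 0 (by simp)
      rw [ContinuousWithinAt, hf.left] at this
      exact this.mono_left (nhdsWithin_le_of_mem (mem_of_superset hev Ioo_subset_Icc_self))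
    have hv0 : Tendsto v (𝓝[>] 0) (𝓝 (v 0)) :=
      (h.continuous_snd.tendsto 0).mono_left nhdsWithin_le_nhds
    have h1 : Tendsto (fun x => deriv f x * y x) (𝓝[>] 0) (𝓝 0) := by
      refine squeeze_zero_norm' (a := fun x => (|deriv f (1 / 2)| + (M + |μ|) * B) * |y x|) ?_ ?_
      · filter_upwards [hev] with x hx
        rw [norm_mul]
        exact mul_le_mul_of_nonneg_right (hbd x hx) (abs_nonneg _)
      · simpa using hy0.abs.const_mul (|deriv f (1 / 2)| + (M + |μ|) * B)
    have h2 := h1.sub (hf0.mul hv0)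
    rw [zero_mul, sub_zero] at h2
    refine tendsto_nhds_unique (tendsto_const_nhds.congr' ?_) h2
    filter_upwards [hev] with x hx using (hw x hx).symm
  subst hw0
  have hD : ∀ x, 0 < y x ^ 2 + v x ^ 2 := by
    intro x
    by_cases hy : y x = 0
    · have := h.nondegenerate x hy
      positivity
    · positivity
  -- As the Wronskian vanishes, `(f, f')` is parallel to `(y, v)`. This quotient is the factor,
  -- written so as to make sense at the zeros of `y`.
  have hA : ∀ x ∈ Ioo (0 : ℝ) 1,
      HasDerivAt (fun x => (f x * y x + deriv f x * v x) / (y x ^ 2 + v x ^ 2)) 0 x := by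
    intro x hx
    refine ((((hf1 x hx).mul (h.hasDerivAt_fst x hx)).add
      ((hf2 x hx).mul (h.hasDerivAt_snd x hx))).div
      (((h.hasDerivAt_fst x hx).pow 2).add ((h.hasDerivAt_snd x hx).pow 2)) (hD x).ne').congr_deriv
      ?_
    rw [div_eq_zero_iff]
    left
    simp
    linear_combination (1 + Q x - μ) * (y x ^ 2 - v x ^ 2) * hw x hx
  obtain ⟨A, hA⟩ := isOpen_Ioo.exists_is_const_of_deriv_eq_zero isPreconnected_Ioo
    (fun x hx => (hA x hx).differentiableAt.differentiableWithinAt) (fun x hx => (hA x hx).deriv)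
  have hfA : EqOn f (fun x => A * y x) (Ioo 0 1) := by
    intro x hx
    have h1 := hA x hx
    have h2 := hw x hx
    rw [div_eq_iff (hD x).ne'] at h1
    have : (f x - A * y x) * (y x ^ 2 + v x ^ 2) = 0 := by
      linear_combination y x * h1 - v x * h2
    exact sub_eq_zero.1 ((mul_eq_zero.1 this).resolve_right (hD x).ne')
  have hfA' : EqOn f (fun x => A * y x) (Icc 0 1) := by
    have hy := h.continuous_fst
    refine hfA.of_subset_closure hf.continuousOn (by fun_prop) Ioo_subset_Icc_self ?_
    rw [closure_Ioo zero_ne_one]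
  refine ⟨A, ?_, hfA'⟩
  rintro rfl
  obtain ⟨x, hx, hne⟩ := hf.ne_zero
  exact hne (by simpa using hfA hx)

/-! ### Oscillation: counting zeros by the angle. -/

/-- At a zero of the sine the angle is a multiple of `π`, and it stays strictly above that multiple
afterwards. Hence each further zero lies at least one multiple higher. -/
lemma IsPruferAngle.card_mul_pi_lt {Q : ℝ → ℝ} {μ : ℝ} {θ : ℝ → ℝ} (h : IsPruferAngle Q μ θ)
    (s : Finset ℝ) : (∀ z ∈ s, 0 < z ∧ Real.sin (θ z) = 0) →
      ∀ x, 0 < x → x ≤ 1 → (∀ z ∈ s, z < x) → s.card * Real.pi < θ x := by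
  induction s using Finset.induction_on_max with
  | empty =>
    intro _ x hx0 hx1 _
    have := h.lt_of_eq_mul_pi (k := 0) le_rfl hx0 hx1 (by simp [h.zero])
    simpa using this
  | insert a s ha ih =>
    intro hs x _ hx1 hsx
    have hax := hsx a (Finset.mem_insert_self a s)
    obtain ⟨ha0, hsin⟩ := hs a (Finset.mem_insert_self a s)
    have h1 := ih (fun z hz => hs z (Finset.mem_insert_of_mem hz)) a ha0 (hax.le.trans hx1) ha
    obtain ⟨k, hk⟩ := Real.sin_eq_zero_iff.1 hsin
    have h2 := h.lt_of_eq_mul_pi ha0.le hax hx1 hk.symm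
    rw [← hk] at h1
    have h3 : (s.card : ℝ) < k := lt_of_mul_lt_mul_right h1 Real.pi_pos.le
    have h4 : (s.card : ℤ) + 1 ≤ k := by
      have : (s.card : ℤ) < k := by exact_mod_cast h3
      omega
    have h5 : ((s.card : ℝ) + 1) ≤ k := by exact_mod_cast h4
    rw [Finset.card_insert_of_notMem (fun hmem => lt_irrefl _ (ha a hmem))]
    push_cast
    exact (mul_le_mul_of_nonneg_right h5 Real.pi_pos.le).trans_lt h2

/-- The eigenfunctions with Dirichlet conditions, normalised by their Prüfer variables. The
`j`-th of them (counted from `0`) has at most `j` zeros in `]0,1[`. -/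
lemma IsFirstDirichletEigenpairs.exists_solutionPairs {q Q : ℝ → ℝ} (hQ : Continuous Q) {M : ℝ}
    (hM : ∀ x, |Q x| ≤ M) (hqQ : ∀ x ∈ Ioo (0 : ℝ) 1, Q x = q x) {n : ℕ} {lam : Fin n → ℝ}
    {h : Fin n → ℝ → ℝ} (hh : IsFirstDirichletEigenpairs q lam h) :
    ∃ (y v : Fin n → ℝ → ℝ) (A : Fin n → ℝ), (∀ j, IsSolutionPair Q (lam j) (y j) (v j)) ∧
      (∀ j, y j 1 = 0) ∧ (∀ j, A j ≠ 0) ∧ (∀ j, ∀ x ∈ Icc (0 : ℝ) 1, h j x = A j * y j x) ∧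
      ∀ j (s : Finset ℝ), (∀ x ∈ s, x ∈ Ioo (0 : ℝ) 1 ∧ y j x = 0) → s.card ≤ j := by
  choose Θ hΘ using exists_isPruferAngle hQ hM
  choose r hr hpair using fun μ => (hΘ μ).exists_isSolutionPair hQ
  choose A hA0 hA using fun j => (hh.eigenfunction j).exists_eq_mul hM hqQ (hpair (lam j))
  refine ⟨fun j x => r (lam j) x * Real.sin (Θ (lam j) x),
    fun j x => r (lam j) x * Real.cos (Θ (lam j) x), A, fun j => hpair (lam j), fun j => ?_, hA0,
    hA, fun j s hs => ?_⟩
  · have := hA j 1 (by simp)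
    rw [(hh.eigenfunction j).right] at this
    exact (mul_eq_zero.1 this.symm).resolve_left (hA0 j)
  -- With more than `j` zeros the end angle at `lam j` exceeds `(j + 1) π`, while it is at most `π /
  -- 2` for a parameter below `-M`. The intermediate value theorem gives eigenvalues with end angles
  -- `π, …, (j + 1) π`, hence `j + 1` distinct indices below `j`.
  · by_contra! hcard
    have hlt : s.card * Real.pi < Θ (lam j) 1 :=
      (hΘ (lam j)).card_mul_pi_lt s (fun z hz => ⟨(hs z hz).1.1,
        (mul_eq_zero.1 (hs z hz).2).resolve_left (hr _ _).ne'⟩) 1 one_pos le_rfl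
        (fun z hz => (hs z hz).1.2)
    have hcont := continuous_pruferAngle_one hM hΘ
    have hlow : Θ (min (-M - 1) (lam j)) 1 ≤ Real.pi / 2 := (hΘ _).le_pi_div_two fun x => by
      have h1 := neg_abs_le (Q x)
      have h2 := hM x
      have h3 := min_le_left (-M - 1) (lam j)
      linarith
    have hex : ∀ l : Fin (j + 1), ∃ i : Fin n, i < j ∧ Θ (lam i) 1 = ((l : ℝ) + 1) * Real.pi := by
      intro l
      have hl : (l : ℝ) + 1 ≤ s.card := by
        have := l.2
        exact_mod_cast (show (l : ℕ) + 1 ≤ s.card by omega)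
      have hlt' : ((l : ℝ) + 1) * Real.pi < Θ (lam j) 1 :=
        (mul_le_mul_of_nonneg_right hl Real.pi_pos.le).trans_lt hlt
      have hge : Real.pi / 2 ≤ ((l : ℝ) + 1) * Real.pi := by
        have : (0 : ℝ) ≤ l := Nat.cast_nonneg _
        nlinarith [Real.pi_pos]
      obtain ⟨μ, hμ, hμe⟩ := intermediate_value_Icc (min_le_right (-M - 1) (lam j))
        hcont.continuousOn ⟨hlow.trans hge, hlt'.le⟩
      have hμe : Θ μ 1 = ((l : ℝ) + 1) * Real.pi := hμe
      have hev : IsDirichletEigenvalue q μ :=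
        (hpair μ).isDirichletEigenvalue hQ hqQ (by
          have := Real.sin_nat_mul_pi (l + 1)
          push_cast at this
          simp [hμe, this])
      obtain ⟨i, rfl⟩ := hh.first μ hev j hμ.2
      refine ⟨i, lt_of_le_of_ne (hh.strictMono.le_iff_le.1 hμ.2) ?_, hμe⟩
      rintro rfl
      exact hlt'.ne' hμe
    choose g hg hgΘ using hex
    have := Finset.card_le_card_of_injOn (s := Finset.univ) (t := Finset.Iio j) g
      (fun l _ => by simpa using hg l) (fun l _ l' _ he => by
        have he : g l = g l' := he
        have h1 := hgΘ l
        rw [he, hgΘ l'] at h1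
        have h2 := mul_right_cancel₀ Real.pi_pos.ne' h1
        ext
        exact_mod_cast (add_right_cancel h2).symm)
    simp at this

/-! ### Rolle's theorem and Liouville's step. -/

/-- Rolle's theorem for finite sets of zeros: the zeros of the derivative interlace. -/
lemma exists_finset_zeros_deriv {I : Set ℝ} (hI : I.OrdConnected) {f f' : ℝ → ℝ}
    (hf : ContinuousOn f I) (hf' : ∀ x ∈ interior I, HasDerivAt f (f' x) x) (s : Finset ℝ) :
    (∀ x ∈ s, x ∈ I ∧ f x = 0) → ∃ t : Finset ℝ, s.card ≤ t.card + 1 ∧ Disjoint s t ∧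
      (∀ x ∈ t, ∃ z ∈ s, x < z) ∧ ∀ x ∈ t, x ∈ interior I ∧ f' x = 0 := by
  induction s using Finset.induction_on_max with
  | empty => exact fun _ => ⟨∅, by simp⟩
  | insert a s ha ih =>
    intro hs
    rcases s.eq_empty_or_nonempty with rfl | hne
    · exact ⟨∅, by simp⟩
    obtain ⟨t, htc, htd, htz, ht⟩ := ih fun x hx => hs x (Finset.mem_insert_of_mem hx)
    set b := s.max' hne
    have hb : b ∈ s := s.max'_mem hne
    have hba : b < a := ha b hb
    obtain ⟨haI, hfa⟩ := hs a (Finset.mem_insert_self a s)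
    obtain ⟨hbI, hfb⟩ := hs b (Finset.mem_insert_of_mem hb)
    have hsub : Icc b a ⊆ I := hI.out hbI haI
    have hint : Ioo b a ⊆ interior I :=
      interior_maximal (Ioo_subset_Icc_self.trans hsub) isOpen_Ioo
    obtain ⟨c, hc, hfc⟩ := exists_hasDerivAt_eq_zero hba (hf.mono hsub) (hfb.trans hfa.symm)
      fun x hx => hf' x (hint hx)
    -- The clause that each point of `t` lies left of some point of `s` serves here: the new point
    -- `c > b` cannot already be in `t`.
    have htb : ∀ x ∈ t, x < b := fun x hx => by
      obtain ⟨z, hz, hxz⟩ := htz x hx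
      exact hxz.trans_le (s.le_max' z hz)
    have hct : c ∉ t := fun h => (htb c h).not_gt hc.1
    have has : a ∉ s := fun h => lt_irrefl _ (ha a h)
    refine ⟨insert c t, ?_, ?_, ?_, ?_⟩
    · rw [Finset.card_insert_of_notMem hct, Finset.card_insert_of_notMem has]
      omega
    · rw [Finset.disjoint_insert_left, Finset.disjoint_insert_right, Finset.mem_insert]
      refine ⟨?_, fun h => (s.le_max' c h).not_gt hc.1, htd⟩
      rintro (h | h)
      · exact hc.2.ne' h
      · exact ((htb a h).trans hba).false
    · intro x hx
      refine ⟨a, Finset.mem_insert_self a s, ?_⟩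
      rcases Finset.mem_insert.1 hx with rfl | hx
      · exact hc.2
      · exact (htb x hx).trans hba
    · intro x hx
      rcases Finset.mem_insert.1 hx with rfl | hx
      · exact ⟨hint hc, hfc⟩
      · exact ht x hx

section Liouville

variable {Q : ℝ → ℝ} {m : ℕ} {lam : Fin (m + 1) → ℝ} {y v : Fin (m + 1) → ℝ → ℝ}

lemma hasDerivAt_linComb (hp : ∀ j, IsSolutionPair Q (lam j) (y j) (v j))
    (β : Fin (m + 1) → ℝ) {x : ℝ} (hx : x ∈ Ioo (0 : ℝ) 1) :
    HasDerivAt (linComb y β) (linComb v β x) x := by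
  unfold linComb
  exact HasDerivAt.fun_sum fun j _ => ((hp j).hasDerivAt_fst x hx).const_mul (β j)

lemma continuous_uncurry_linComb {w : Fin (m + 1) → ℝ → ℝ} (hw : ∀ j, Continuous (w j)) :
    Continuous fun p : (Fin (m + 1) → ℝ) × ℝ => linComb w p.1 p.2 := by
  unfold linComb
  fun_prop

lemma continuous_linComb {w : Fin (m + 1) → ℝ → ℝ} (hw : ∀ j, Continuous (w j))
    (β : Fin (m + 1) → ℝ) : Continuous (linComb w β) :=
  (continuous_uncurry_linComb hw).comp (Continuous.prodMk_right β)

/-- Liouville's step: applying `-d²/dx² + Q - lam 0` to a linear combination of eigenfunctions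
does not decrease the number of zeros in `]0,1[`, even if the multiple zeros are counted twice. -/
lemma exists_finset_zeros_liouville (hp : ∀ j, IsSolutionPair Q (lam j) (y j) (v j))
    (h1 : ∀ j, y j 1 = 0) (h0 : ∀ x ∈ Ioo (0 : ℝ) 1, y 0 x ≠ 0) (β : Fin (m + 1) → ℝ)
    (s d : Finset ℝ) (hs : ∀ x ∈ s, x ∈ Ioo (0 : ℝ) 1 ∧ linComb y β x = 0) (hds : d ⊆ s)
    (hd : ∀ x ∈ d, linComb v β x = 0) :
    ∃ t : Finset ℝ, s.card + d.card ≤ t.card ∧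
      ∀ x ∈ t, x ∈ Ioo (0 : ℝ) 1 ∧ linComb y (fun j => (lam j - lam 0) * β j) x = 0 := by
  have hS := fun x hx => hasDerivAt_linComb hp β (x := x) hx
  have hT : ∀ x ∈ Ioo (0 : ℝ) 1,
      HasDerivAt (linComb v β) (∑ j, β j * ((Q x - lam j) * y j x)) x := by
    intro x hx
    unfold linComb
    exact HasDerivAt.fun_sum fun j _ => ((hp j).hasDerivAt_snd x hx).const_mul (β j)
  have hSc := continuous_linComb (fun j => (hp j).continuous_fst) β
  have hTc := continuous_linComb (fun j => (hp j).continuous_snd) β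
  have hyc := (hp 0).continuous_fst
  have hvc := (hp 0).continuous_snd
  have hquot : ∀ x ∈ Ioo (0 : ℝ) 1, HasDerivAt (fun x => linComb y β x / y 0 x)
      ((linComb v β x * y 0 x - linComb y β x * v 0 x) / y 0 x ^ 2) x := fun x hx =>
    (hS x hx).div ((hp 0).hasDerivAt_fst x hx) (h0 x hx)
  obtain ⟨t, htc, htd, -, ht⟩ := exists_finset_zeros_deriv ordConnected_Ioo
    (fun x hx => (hquot x hx).continuousAt.continuousWithinAt)
    (fun x hx => hquot x (interior_subset hx)) s
    (fun x hx => ⟨(hs x hx).1, by simp [(hs x hx).2]⟩)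
  simp only [interior_Ioo] at ht
  have htd' : Disjoint t d := (htd.mono_left hds).symm
  have hIoo : ∀ x ∈ t ∪ d, x ∈ Ioo (0 : ℝ) 1 := fun x hx => by
    rcases Finset.mem_union.1 hx with hx | hx
    · exact (ht x hx).1
    · exact (hs x (hds hx)).1
  -- The Wronskian vanishes on `t`, on the multiple zeros `d` and at both end points. The two end
  -- points compensate the one zero lost in each application of Rolle.
  have hcard : (insert 0 (insert 1 (t ∪ d))).card = t.card + d.card + 2 := by
    rw [Finset.card_insert_of_notMem, Finset.card_insert_of_notMem,
      Finset.card_union_of_disjoint htd']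
    · exact fun h => lt_irrefl _ (hIoo 1 h).2
    · rw [Finset.mem_insert, not_or]
      exact ⟨zero_ne_one, fun h => lt_irrefl _ (hIoo 0 h).1⟩
  have hW : ∀ x ∈ Ioo (0 : ℝ) 1,
      HasDerivAt (fun x => linComb v β x * y 0 x - linComb y β x * v 0 x)
        (-(y 0 x * linComb y (fun j => (lam j - lam 0) * β j) x)) x := by
    intro x hx
    refine (((hT x hx).mul ((hp 0).hasDerivAt_fst x hx)).sub
      ((hS x hx).mul ((hp 0).hasDerivAt_snd x hx))).congr_deriv ?_
    have : ∑ j, β j * ((Q x - lam j) * y j x) = (Q x - lam 0) * linComb y β x -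
        linComb y (fun j => (lam j - lam 0) * β j) x := by
      simp only [linComb, Finset.mul_sum, ← Finset.sum_sub_distrib]
      exact Finset.sum_congr rfl fun j _ => by ring
    rw [this]
    ring
  obtain ⟨t', htc', -, -, ht'⟩ := exists_finset_zeros_deriv
    (f := fun x => linComb v β x * y 0 x - linComb y β x * v 0 x)
    (f' := fun x => -(y 0 x * linComb y (fun j => (lam j - lam 0) * β j) x))
    (ordConnected_Icc (a := (0 : ℝ)) (b := 1)) (by fun_prop)
    (fun x hx => hW x (by rwa [interior_Icc] at hx)) (insert 0 (insert 1 (t ∪ d))) (by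
      intro x hx
      simp only [Finset.mem_insert, Finset.mem_union] at hx
      rcases hx with rfl | rfl | hx | hx
      · simp [(hp 0).zero, linComb, fun j => (hp j).zero]
      · simp [h1, linComb]
      · refine ⟨Ioo_subset_Icc_self (ht x hx).1, ?_⟩
        exact (div_eq_zero_iff.1 (ht x hx).2).resolve_right (pow_ne_zero 2 (h0 x (ht x hx).1))
      · refine ⟨Ioo_subset_Icc_self (hs x (hds hx)).1, ?_⟩
        simp [hd x hx, (hs x (hds hx)).2])
  refine ⟨t', by omega, fun x hx => ?_⟩
  have hxI : x ∈ Ioo (0 : ℝ) 1 := by simpa using (ht' x hx).1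
  exact ⟨hxI, (mul_eq_zero.1 (neg_eq_zero.1 (ht' x hx).2)).resolve_left (h0 x hxI)⟩

lemma exists_finset_zeros_liouville_iterate (hp : ∀ j, IsSolutionPair Q (lam j) (y j) (v j))
    (h1 : ∀ j, y j 1 = 0) (h0 : ∀ x ∈ Ioo (0 : ℝ) 1, y 0 x ≠ 0) (β : Fin (m + 1) → ℝ)
    (s : Finset ℝ) (hs : ∀ x ∈ s, x ∈ Ioo (0 : ℝ) 1 ∧ linComb y β x = 0) (k : ℕ) :
    ∃ t : Finset ℝ, s.card ≤ t.card ∧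
      ∀ x ∈ t, x ∈ Ioo (0 : ℝ) 1 ∧ linComb y (fun j => (lam j - lam 0) ^ k * β j) x = 0 := by
  induction k with
  | zero => exact ⟨s, le_rfl, by simpa using hs⟩
  | succ k ih =>
    obtain ⟨t, htc, ht⟩ := ih
    obtain ⟨t', htc', ht'⟩ := exists_finset_zeros_liouville hp h1 h0 _ t ∅ ht (by simp) (by simp)
    refine ⟨t', by simpa using htc.trans htc', fun x hx => ⟨(ht' x hx).1, ?_⟩⟩
    rw [← (ht' x hx).2]
    congr 1
    ext j
    ring

/-! ### Passage to the limit and the Chebyshev property. -/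

/-- Zeros of linear combinations persist in the limit if the limit has only simple zeros. -/
lemma exists_finset_zeros_of_tendsto (hp : ∀ j, IsSolutionPair Q (lam j) (y j) (v j))
    (h1 : ∀ j, y j 1 = 0) {a : ℕ → Fin (m + 1) → ℝ} {α : Fin (m + 1) → ℝ}
    (ha : Tendsto a atTop (𝓝 α)) (hα : ∀ x, linComb y α x = 0 → linComb v α x ≠ 0) {N : ℕ}
    (hz : ∀ k, ∃ t : Finset ℝ, N ≤ t.card ∧ ∀ x ∈ t, x ∈ Ioo (0 : ℝ) 1 ∧ linComb y (a k) x = 0) :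
    ∃ t : Finset ℝ, N ≤ t.card ∧ ∀ x ∈ t, x ∈ Ioo (0 : ℝ) 1 ∧ linComb y α x = 0 := by
  -- The end points are tracked along with the `N` interior zeros, so a zero escaping to the
  -- boundary is also a collision of two zeros.
  have hex : ∀ k, ∃ e : Fin (N + 2) → ℝ, StrictMono e ∧
      ∀ i, e i ∈ Icc (0 : ℝ) 1 ∧ linComb y (a k) (e i) = 0 := by
    intro k
    obtain ⟨t, htc, ht⟩ := hz k
    obtain ⟨u, hut, huc⟩ := Finset.exists_subset_card_eq htc
    have hcard : (insert 0 (insert 1 u)).card = N + 2 := by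
      rw [Finset.card_insert_of_notMem, Finset.card_insert_of_notMem, huc]
      · exact fun h => lt_irrefl _ (ht 1 (hut h)).1.2
      · rw [Finset.mem_insert, not_or]
        exact ⟨zero_ne_one, fun h => lt_irrefl _ (ht 0 (hut h)).1.1⟩
    refine ⟨(insert 0 (insert 1 u)).orderEmbOfFin hcard, OrderEmbedding.strictMono _, fun i => ?_⟩
    have := Finset.orderEmbOfFin_mem _ hcard i
    generalize (insert 0 (insert 1 u)).orderEmbOfFin hcard i = x at this
    simp only [Finset.mem_insert] at this
    rcases this with rfl | rfl | hx
    · simp [linComb, fun j => (hp j).zero]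
    · simp [linComb, h1]
    · exact ⟨Ioo_subset_Icc_self (ht x (hut hx)).1, (ht x (hut hx)).2⟩
  choose e hemono he using hex
  obtain ⟨x, hxI, φ, hφ, hx⟩ := (isCompact_univ_pi fun _ : Fin (N + 2) =>
    isCompact_Icc (a := (0 : ℝ)) (b := 1)).tendsto_subseq (x := e) fun k i _ => (he k i).1
  have hxi : ∀ i, Tendsto (fun k => e (φ k) i) atTop (𝓝 (x i)) := fun i =>
    (tendsto_pi_nhds.1 hx) i
  have haφ : Tendsto (fun k => a (φ k)) atTop (𝓝 α) := ha.comp hφ.tendsto_atTop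
  have hlim : ∀ {w : Fin (m + 1) → ℝ → ℝ} (_ : ∀ j, Continuous (w j)) {z : ℕ → ℝ} {z' : ℝ},
      Tendsto z atTop (𝓝 z') → (∀ k, linComb w (a (φ k)) (z k) = 0) → linComb w α z' = 0 := by
    intro w hw z z' hzz h0
    have := ((continuous_uncurry_linComb hw).tendsto (α, z')).comp (haφ.prodMk_nhds hzz)
    refine tendsto_nhds_unique this (tendsto_const_nhds.congr fun k => ?_)
    exact (h0 k).symm
  have hzero : ∀ i, linComb y α (x i) = 0 := fun i =>
    hlim (fun j => (hp j).continuous_fst) (hxi i) fun k => (he (φ k) i).2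
  have hinj : ∀ i i', i < i' → x i ≠ x i' := by
    intro i i' hii heq
    -- Between two colliding zeros Rolle gives a zero of the derivative, whose limit is a multiple
    -- zero of the limit function.
    have hroll : ∀ k, ∃ z ∈ Ioo (e (φ k) i) (e (φ k) i'), linComb v (a (φ k)) z = 0 := by
      intro k
      refine exists_hasDerivAt_eq_zero (hemono (φ k) hii)
        (continuous_linComb (fun j => (hp j).continuous_fst) _).continuousOn
        ((he (φ k) i).2.trans (he (φ k) i').2.symm) fun z hz => hasDerivAt_linComb hp _
          ⟨(he (φ k) i).1.1.trans_lt hz.1, hz.2.trans_le (he (φ k) i').1.2⟩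
    choose z hz hvz using hroll
    refine hα (x i) (hzero i) (hlim (fun j => (hp j).continuous_snd) ?_ hvz)
    exact tendsto_of_tendsto_of_tendsto_of_le_of_le (hxi i) (heq ▸ hxi i')
      (fun k => (hz k).1.le) (fun k => (hz k).2.le)
  have hinj' : Function.Injective x := fun i i' h => by
    rcases lt_trichotomy i i' with hlt | heq | hlt
    · exact absurd h (hinj i i' hlt)
    · exact heq
    · exact absurd h.symm (hinj i' i hlt)
  refine ⟨Finset.univ.image x \ {0, 1}, ?_, fun z hz => ?_⟩
  · have h2 := Finset.le_card_sdiff ({0, 1} : Finset ℝ) (Finset.univ.image x)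
    rw [Finset.card_image_of_injective _ hinj', Finset.card_univ, Fintype.card_fin] at h2
    have h3 : ({0, 1} : Finset ℝ).card ≤ 2 := Finset.card_le_two
    omega
  · simp only [Finset.mem_sdiff, Finset.mem_image, Finset.mem_univ, true_and, Finset.mem_insert,
      Finset.mem_singleton, not_or] at hz
    obtain ⟨⟨i, rfl⟩, hne0, hne1⟩ := hz
    have := hxI i (mem_univ i)
    exact ⟨⟨lt_of_le_of_ne this.1 (Ne.symm hne0), lt_of_le_of_ne this.2 hne1⟩, hzero i⟩

/-- The eigenfunctions form a Chebyshev system on `]0,1[`. -/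
lemma card_zeros_linComb_le (hp : ∀ j, IsSolutionPair Q (lam j) (y j) (v j))
    (h1 : ∀ j, y j 1 = 0) (hlam : StrictMono lam)
    (hosc : ∀ j (s : Finset ℝ), (∀ x ∈ s, x ∈ Ioo (0 : ℝ) 1 ∧ y j x = 0) → s.card ≤ j)
    {β : Fin (m + 1) → ℝ} (hβ : β ≠ 0) (s : Finset ℝ)
    (hs : ∀ x ∈ s, x ∈ Ioo (0 : ℝ) 1 ∧ linComb y β x = 0) : s.card ≤ m := by
  have h0 : ∀ x ∈ Ioo (0 : ℝ) 1, y 0 x ≠ 0 := fun x hx h => by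
    have := hosc 0 {x} (by simpa [h] using hx)
    simp at this
  obtain ⟨J, hJ, hmax⟩ : ∃ J, β J ≠ 0 ∧ ∀ j, J < j → β j = 0 := by
    obtain ⟨j₀, hj₀⟩ := Function.ne_iff.1 hβ
    obtain ⟨J, hJ, hJm⟩ := (Finset.univ.filter fun j => β j ≠ 0).exists_maximal
      ⟨j₀, by simpa using hj₀⟩
    refine ⟨J, by simpa using hJ, fun j hj => ?_⟩
    by_contra hne
    exact hj.not_ge (hJm (by simpa using hne) hj.le)
  have hsingle : ∀ w : Fin (m + 1) → ℝ → ℝ, ∀ x, linComb w (Pi.single J (β J)) x = β J * w J x := by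
    intro w x
    simp [linComb, Pi.single_apply]
  -- The largest factor `lam J - lam 0` dominates. For `J = 0` it is zero, but then the combination
  -- already reduces to its single term.
  have hlim : Tendsto (fun k : ℕ => fun j => ((lam j - lam 0) / (lam J - lam 0)) ^ k * β j) atTop
      (𝓝 (Pi.single J (β J))) ∨ J = 0 := by
    by_cases hJ0 : J = 0
    · exact Or.inr hJ0
    refine Or.inl (tendsto_pi_nhds.2 fun j => ?_)
    have hpos : 0 < lam J - lam 0 := sub_pos.2 (hlam (Fin.pos_iff_ne_zero.2 hJ0))
    rcases lt_trichotomy j J with hlt | rfl | hgt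
    · have h2 : 0 ≤ lam j - lam 0 := sub_nonneg.2 (hlam.monotone (Fin.zero_le j))
      have h3 := tendsto_pow_atTop_nhds_zero_of_lt_one (div_nonneg h2 hpos.le)
        ((div_lt_one hpos).2 (by linarith [hlam hlt]))
      simpa [Pi.single_apply, hlt.ne] using h3.mul_const (β j)
    · simp [div_self hpos.ne']
    · simp [hmax j hgt, hgt.ne']
  obtain ⟨t, htc, ht⟩ : ∃ t : Finset ℝ, s.card ≤ t.card ∧
      ∀ x ∈ t, x ∈ Ioo (0 : ℝ) 1 ∧ linComb y (Pi.single J (β J)) x = 0 := by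
    rcases hlim with hlim | rfl
    · refine exists_finset_zeros_of_tendsto hp h1 hlim (fun x hx => ?_) fun k => ?_
      · rw [hsingle] at hx ⊢
        exact mul_ne_zero hJ ((hp J).nondegenerate x ((mul_eq_zero.1 hx).resolve_left hJ))
      · obtain ⟨t, htc, ht⟩ := exists_finset_zeros_liouville_iterate hp h1 h0 β s hs k
        refine ⟨t, htc, fun x hx => ⟨(ht x hx).1, ?_⟩⟩
        have : linComb y (fun j => ((lam j - lam 0) / (lam J - lam 0)) ^ k * β j) x =
            ((lam J - lam 0) ^ k)⁻¹ * linComb y (fun j => (lam j - lam 0) ^ k * β j) x := by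
          simp only [linComb, Finset.mul_sum, div_pow]
          exact Finset.sum_congr rfl fun j _ => by ring
        rw [this, (ht x hx).2, mul_zero]
    · refine ⟨s, le_rfl, fun x hx => ⟨(hs x hx).1, ?_⟩⟩
      rw [← (hs x hx).2]
      congr 1
      ext j
      by_cases hj : j = 0
      · simp [hj]
      · simp [hj, hmax j (Fin.pos_iff_ne_zero.2 hj)]
  have := hosc J t fun x hx => ⟨(ht x hx).1, by
    have h2 := (ht x hx).2
    rw [hsingle] at h2
    exact (mul_eq_zero.1 h2).resolve_left hJ⟩
  have := J.2
  omega

/-- A nonzero linear combination with the maximal number of zeros in `]0,1[` has only simple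
zeros there. -/
lemma linComb_deriv_ne_zero (hp : ∀ j, IsSolutionPair Q (lam j) (y j) (v j))
    (h1 : ∀ j, y j 1 = 0) (hlam : StrictMono lam)
    (hosc : ∀ j (s : Finset ℝ), (∀ x ∈ s, x ∈ Ioo (0 : ℝ) 1 ∧ y j x = 0) → s.card ≤ j)
    {β : Fin (m + 1) → ℝ} (hβ : β ≠ 0) (s : Finset ℝ)
    (hs : ∀ x ∈ s, x ∈ Ioo (0 : ℝ) 1 ∧ linComb y β x = 0) (hcard : s.card = m) {z : ℝ}
    (hz : z ∈ s) : linComb v β z ≠ 0 := by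
  have h0 : ∀ x ∈ Ioo (0 : ℝ) 1, y 0 x ≠ 0 := fun x hx h => by
    have := hosc 0 {x} (by simpa [h] using hx)
    simp at this
  intro hv
  obtain ⟨t, htc, ht⟩ := exists_finset_zeros_liouville hp h1 h0 β s {z} hs (by simpa using hz)
    (by simpa using hv)
  -- Otherwise only the term of index `0` remains, and it has no zero in `]0,1[`.
  have hTβ : (fun j => (lam j - lam 0) * β j) ≠ 0 := by
    intro hT
    have hj : ∀ j, j ≠ 0 → β j = 0 := fun j hj =>
      (mul_eq_zero.1 (congrFun hT j)).resolve_left (sub_ne_zero.2 (hlam.injective.ne hj))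
    have hS := (hs z hz).2
    rw [linComb, Finset.sum_eq_single 0 (fun j _ h => by simp [hj j h]) (by simp)] at hS
    have hβ0 := (mul_eq_zero.1 hS).resolve_right (h0 z (hs z hz).1)
    refine hβ (funext fun j => ?_)
    by_cases h : j = 0
    · rw [h, hβ0]; rfl
    · exact hj j h
  have := card_zeros_linComb_le hp h1 hlam hosc hTβ t ht
  rw [Finset.card_singleton] at htc
  omega

end Liouville

/-! ### The Slater determinant in a Chebyshev system. -/

section Slater

variable {m : ℕ} {h : Fin (m + 1) → ℝ → ℝ}

/-- Expansion of the Slater determinant along the last column. -/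
lemma exists_slater_snoc_eq_linComb (h : Fin (m + 1) → ℝ → ℝ) (c : Fin m → ℝ) :
    ∃ b : Fin (m + 1) → ℝ, ∀ x, slater h (Fin.snoc (α := fun _ => ℝ) c x) = linComb h b x := by
  refine ⟨fun i => (-1) ^ ((i : ℕ) + m) *
    (Matrix.of fun k j : Fin m => h (i.succAbove k) (c j)).det, fun x => ?_⟩
  rw [slater, Matrix.det_succ_column _ (Fin.last m), linComb]
  refine Finset.sum_congr rfl fun i _ => ?_
  have : (Matrix.of fun i j => h i (Fin.snoc (α := fun _ => ℝ) c x j)).submatrix i.succAbove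
      (Fin.last m).succAbove = Matrix.of fun k j : Fin m => h (i.succAbove k) (c j) := by
    ext k j
    simp
  rw [this]
  simp
  ring

lemma slater_snoc_apply_self (h : Fin (m + 1) → ℝ → ℝ) (c : Fin m → ℝ) (k : Fin m) :
    slater h (Fin.snoc (α := fun _ => ℝ) c (c k)) = 0 :=
  Matrix.det_zero_of_column_eq (Fin.castSucc_lt_last k).ne fun i => by simp

/-- In a Chebyshev system, a linear combination with the maximal number of zeros is a multiple of
the Slater determinant. -/
lemma exists_linComb_eq_mul_slater {I : Set ℝ} (hI : I.Infinite)
    (hcheb : ∀ b : Fin (m + 1) → ℝ, b ≠ 0 → ∀ s : Finset ℝ,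
      (∀ x ∈ s, x ∈ I ∧ linComb h b x = 0) → s.card ≤ m)
    {b : Fin (m + 1) → ℝ} (hb : b ≠ 0) {c : Fin m → ℝ} (hc : Function.Injective c)
    (hcI : ∀ j, c j ∈ I) (hcb : ∀ j, linComb h b (c j) = 0) :
    ∃ C : ℝ, C ≠ 0 ∧ ∀ x, linComb h b x = C * slater h (Fin.snoc (α := fun _ => ℝ) c x) := by
  obtain ⟨x₀, hx₀I, hx₀c⟩ := hI.exists_notMem_finset (Finset.univ.image c)
  have hzero : ∀ b' : Fin (m + 1) → ℝ, (∀ j, linComb h b' (c j) = 0) → linComb h b' x₀ = 0 →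
      b' = 0 := by
    intro b' h1 h2
    by_contra hne
    have := hcheb b' hne (insert x₀ (Finset.univ.image c)) (by
      intro x hx
      rcases Finset.mem_insert.1 hx with rfl | hx
      · exact ⟨hx₀I, h2⟩
      · obtain ⟨j, -, rfl⟩ := Finset.mem_image.1 hx
        exact ⟨hcI j, h1 j⟩)
    rw [Finset.card_insert_of_notMem hx₀c, Finset.card_image_of_injective _ hc,
      Finset.card_univ, Fintype.card_fin] at this
    omega
  -- A left kernel vector would be a nonzero combination vanishing at `m + 1` points.
  have hdet : slater h (Fin.snoc (α := fun _ => ℝ) c x₀) ≠ 0 := by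
    intro hdet
    obtain ⟨w, hw0, hw⟩ := Matrix.exists_vecMul_eq_zero_iff.2 hdet
    have hw' : ∀ j, linComb h w (Fin.snoc (α := fun _ => ℝ) c x₀ j) = 0 := fun j =>
      congrFun hw j
    refine hw0 (hzero w (fun j => ?_) ?_)
    · simpa using hw' j.castSucc
    · simpa using hw' (Fin.last m)
  obtain ⟨b', hb'⟩ := exists_slater_snoc_eq_linComb h c
  -- This `C` makes the two sides agree at `x₀`. They also agree at the `c j`, so their coefficients
  -- coincide.
  set C := linComb h b x₀ / slater h (Fin.snoc (α := fun _ => ℝ) c x₀) with hC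
  have hsub : ∀ x, linComb h (fun j => b j - C * b' j) x = linComb h b x -
      C * slater h (Fin.snoc (α := fun _ => ℝ) c x) := by
    intro x
    rw [hb']
    simp only [linComb, Finset.mul_sum, ← Finset.sum_sub_distrib]
    exact Finset.sum_congr rfl fun j _ => by ring
  have heq := hzero (fun j => b j - C * b' j)
    (fun j => by rw [hsub, hcb, slater_snoc_apply_self]; simp)
    (by rw [hsub, hC, div_mul_cancel₀ _ hdet, sub_self])
  refine ⟨C, div_ne_zero (fun h0 => hb (hzero b hcb h0)) hdet, fun x => ?_⟩
  have := hsub x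
  rw [heq] at this
  simp only [linComb, Pi.zero_apply, zero_mul, Finset.sum_const_zero] at this ⊢
  linarith

end Slater

/-! ### The theorem. -/

/-- The number of eigenfunctions is `n = m + 1`. -/
theorem proposition6p3 (q : ℝ → ℝ) (U : Set ℝ) (hU : IsOpen U) (hIU : Icc (0 : ℝ) 1 ⊆ U)
    (hq : ContDiffOn ℝ ∞ q U)
    (m : ℕ) (lam : Fin (m + 1) → ℝ) (h : Fin (m + 1) → ℝ → ℝ)
    (hh : IsFirstDirichletEigenpairs q lam h)
    (b : Fin (m + 1) → ℝ) (hb : b ≠ 0) :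
    {x ∈ Ioo (0 : ℝ) 1 | linComb h b x = 0}.encard ≤ m ∧
    ∀ c : Fin m → ℝ, StrictMono c →
      range c = {x ∈ Ioo (0 : ℝ) 1 | linComb h b x = 0} →
      (∃ C : ℝ, C ≠ 0 ∧ ∀ x ∈ Icc (0 : ℝ) 1,
        linComb h b x = C * slater h (Fin.snoc (α := fun _ => ℝ) c x)) ∧
      ∀ j, IsZeroOfOrder (linComb h b) (c j) 1 := by
  have hqc : ContinuousOn q (Icc 0 1) := hq.continuousOn.mono hIU
  -- Extending by the end values gives a potential continuous and bounded on all of `ℝ`, as the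
  -- Prüfer lemmas require.
  set Q : ℝ → ℝ := IccExtend zero_le_one ((Icc 0 1).domRestrict q) with hQdef
  have hQ : Continuous Q := (continuousOn_iff_continuous_domRestrict.1 hqc).Icc_extend'
  have hqQ : ∀ x ∈ Ioo (0 : ℝ) 1, Q x = q x := fun x hx =>
    IccExtend_of_mem _ _ (Ioo_subset_Icc_self hx)
  obtain ⟨M, hM⟩ : ∃ M, ∀ x, |Q x| ≤ M := by
    obtain ⟨M, hM⟩ := isCompact_Icc.exists_bound_of_continuousOn hqc
    exact ⟨M, fun x => hM _ (projIcc (0 : ℝ) 1 zero_le_one x).2⟩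
  obtain ⟨y, v, A, hp, h1, hA0, hA, hosc⟩ := hh.exists_solutionPairs hQ hM hqQ
  have hlin : ∀ b : Fin (m + 1) → ℝ, ∀ x ∈ Icc (0 : ℝ) 1,
      linComb h b x = linComb y (fun j => b j * A j) x := fun b x hx =>
    Finset.sum_congr rfl fun j _ => by rw [hA j x hx, mul_assoc]
  have hne : ∀ b : Fin (m + 1) → ℝ, b ≠ 0 → (fun j => b j * A j) ≠ 0 := fun b hb h0 =>
    hb (funext fun j => (mul_eq_zero.1 (congrFun h0 j)).resolve_right (hA0 j))
  have hcheb : ∀ b : Fin (m + 1) → ℝ, b ≠ 0 → ∀ s : Finset ℝ,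
      (∀ x ∈ s, x ∈ Ioo (0 : ℝ) 1 ∧ linComb h b x = 0) → s.card ≤ m := fun b hb s hs =>
    card_zeros_linComb_le hp h1 hh.strictMono hosc (hne b hb) s fun x hx =>
      ⟨(hs x hx).1, by rw [← hlin b x (Ioo_subset_Icc_self (hs x hx).1)]; exact (hs x hx).2⟩
  refine ⟨?_, fun c hc hrange => ?_⟩
  · by_contra! hlt
    obtain ⟨t, hts, htc⟩ := exists_subset_encard_eq (k := m + 1) (Order.add_one_le_of_lt hlt)
    have hfin : t.Finite := finite_of_encard_eq_coe (k := m + 1) (by simpa using htc)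
    have := hcheb b hb hfin.toFinset fun x hx => hts (hfin.mem_toFinset.1 hx)
    rw [hfin.encard_eq_coe_toFinset_card] at htc
    have htc' : hfin.toFinset.card = m + 1 := by exact_mod_cast htc
    omega
  · have hcz : ∀ j, c j ∈ Ioo (0 : ℝ) 1 ∧ linComb h b (c j) = 0 := fun j => by
      have := mem_range_self (f := c) j
      rwa [hrange] at this
    refine ⟨?_, fun j => ⟨fun i hi => ?_, ?_⟩⟩
    · obtain ⟨C, hC, hCx⟩ := exists_linComb_eq_mul_slater (Ioo_infinite zero_lt_one) hcheb hb
        hc.injective (fun j => (hcz j).1) (fun j => (hcz j).2)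
      exact ⟨C, hC, fun x _ => hCx x⟩
    · rw [Nat.lt_one_iff.1 hi, iteratedDeriv_zero]
      exact (hcz j).2
    · have hev : linComb h b =ᶠ[𝓝 (c j)] linComb y (fun j => b j * A j) := by
        filter_upwards [Ioo_mem_nhds (hcz j).1.1 (hcz j).1.2] with x hx
        exact hlin b x (Ioo_subset_Icc_self hx)
      rw [iteratedDeriv_one, hev.deriv_eq, (hasDerivAt_linComb hp _ (hcz j).1).deriv]
      refine linComb_deriv_ne_zero hp h1 hh.strictMono hosc (hne b hb) (Finset.univ.image c)
        (fun x hx => ?_) ?_ (Finset.mem_image_of_mem c (Finset.mem_univ j))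
      · obtain ⟨i, -, rfl⟩ := Finset.mem_image.1 hx
        refine ⟨(hcz i).1, ?_⟩
        rw [← hlin b _ (Ioo_subset_Icc_self (hcz i).1)]
        exact (hcz i).2
      · rw [Finset.card_image_of_injective _ hc.injective, Finset.card_univ, Fintype.card_fin]
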